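/- Let $\Sigma$ be a finite set. The series-rational expressions $\mathcal T_\Sigma$ are generated by $e,f ::= 0 \mid 1 \mid a\in\Sigma \mid e+f \mid e\cdot f \mid e\parallel f \mid e^*$. Let $\simeq$ be the smallest congruence on $\mathcal T_\Sigma$ with $e+0\simeq e$, $e+e\simeq e$, $e+f\simeq f+e$, $e+(f+g)\simeq(e+f)+g$, $0\cdot e\simeq 0$, $e\cdot 0\simeq 0$, $0\parallel e\simeq 0$, $e\parallel 0\simeq 0$. Write $\binom{S}{2}$ for the set of multisets of size two over $S$; put $\{g,h\}\simeq\{g',h'\}$ when $g\simeq g'$ and $h\simeq h'$. **Pomset automata.** A pomset automaton (PA) $A=\langle Q,\delta,\gamma,F\rangle$ consists of a set $Q$ of states, $F\subseteq Q$, and functions $\delta:Q\times\Sigma\to Q$ and $\gamma:Q\times\binom{Q}{2}\to Q$, together with a sink state $\bot\in Q\setminus F$ such that $\delta(\bot,a)=\bot$ and $\gamma(\bot,\phi)=\bot$ for all $a\in\Sigma$, $\phi\in\binom Q2$. The *support* of $q\in Q$ is $\pi_A(q)=\{\{r,s\}\in\binom Q2 : \gamma(q,\{r,s\}),r,s\neq\bot\}$.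 The *reach* $\rho_A(q)$ is the smallest set containing $q$ such that, if $q'\in\rho_A(q)$, then $\delta(q',a)\in\rho_A(q)$ for all $a\in\Sigma$ and $\gamma(q',\phi)\in\rho_A(q)$ for all $\phi\in\pi_A(q')$. A *fork hierarchy* for $A$ is an irreflexive transitive relation $\prec$ on $Q$ such that: if $\{r,s\}\in\pi_A(q)$ then $r\prec q$ and $s\prec q$; if $r\prec\delta(q,a)$ for some $a\in\Sigma$ then $r\prec q$; if $\phi\in\pi_A(q)$ and $r\prec\gamma(q,\phi)$ then $r\prec q$. $A$ is *fork-acyclic* if it has a fork hierarchy, and *bounded* if it has a well-founded fork hierarchy and $\pi_A(q)$, $\rho_A(q)$ are finite for all $q\in Q$. **The quotiented syntactic PA.** Let $F_\Sigma$ be the smallest subset of $\mathcal T_\Sigma$ such that: $1\in F_\Sigma$; all $e^*\in F_\Sigma$; $e+f\in F_\Sigma$ if $e\in F_\Sigma$ or $f\in F_\Sigma$; and $e\cdot f,\ e\parallel f\in F_\Sigma$ if $e,f\in F_\Sigma$. Write $e\star f$ for $f$ if $e\in F_\Sigma$ and $0$ otherwise, and $[P]$, for a condition $P$, for the expression $1$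 if $P$ holds and $0$ otherwise. For $a,b\in\Sigma$ and $\phi\in\binom{\mathcal T_\Sigma}{2}$ define $$\begin{aligned} \delta_\Sigma(0,a)&=\delta_\Sigma(1,a)=0, & \gamma_\Sigma(0,\phi)&=\gamma_\Sigma(1,\phi)=0,\\ \delta_\Sigma(b,a)&=[a=b], & \gamma_\Sigma(b,\phi)&=0,\\ \delta_\Sigma(e+f,a)&=\delta_\Sigma(e,a)+\delta_\Sigma(f,a), & \gamma_\Sigma(e+f,\phi)&=\gamma_\Sigma(e,\phi)+\gamma_\Sigma(f,\phi),\\ \delta_\Sigma(e\cdot f,a)&=\delta_\Sigma(e,a)\cdot f+e\star\delta_\Sigma(f,a), & \gamma_\Sigma(e\cdot f,\phi)&=\gamma_\Sigma(e,\phi)\cdot f+e\star\gamma_\Sigma(f,\phi),\\ \delta_\Sigma(e\parallel f,a)&=e\star\delta_\Sigma(f,a)+f\star\delta_\Sigma(e,a), & \gamma_\Sigma(e\parallel f,\phi)&=[\phi\simeq\{e,f\}]+e\star\gamma_\Sigma(f,\phi)+f\star\gamma_\Sigma(e,\phi),\\ \delta_\Sigma(e^*,a)&=\delta_\Sigma(e,a)\cdot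 e^*, & \gamma_\Sigma(e^*,\phi)&=\gamma_\Sigma(e,\phi)\cdot e^*. \end{aligned}$$ Let $\mathcal Q_\Sigma$ be the set of $\simeq$-classes $[e]$ of expressions. The quotiented syntactic PA is $A_\simeq=\langle\mathcal Q_\Sigma,\delta_\simeq,\gamma_\simeq,F_\simeq\rangle$ with sink state $[0]$, where $\delta_\simeq([e],a)=[\delta_\Sigma(e,a)]$; $\gamma_\simeq([e],\{[f],[g]\})$ is $[0]$ if $f\simeq 0$ or $g\simeq 0$, and $[\gamma_\Sigma(e,\{f,g\})]$ otherwise; and $F_\simeq=\{[e]:e\in F_\Sigma\}$ (all of these are well-defined). **Parallel depth.** Let $d(e)=0$ if $e\simeq 0$, and otherwise $d(1)=0$, $d(a)=1$, $d(e+f)=d(e\cdot f)=\max(d(e),d(f))$, $d(e\parallel f)=\max(d(e),d(f))+1$, $d(e^*)=d(e)$. This number depends only on $[e]$; put $[e]\prec[f]$ if and only if $d(e)<d(f)$. **Theorem.** The relation $\prec$ is a well-founded fork hierarchy for $A_\simeq$; in particular $A_\simeq$ is fork-acyclic. For every $q\in\mathcal Q_\Sigma$ the reach $\rho_\simeq(q)$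 and the support $\pi_\simeq(q)$ in $A_\simeq$ are finite. Hence $A_\simeq$ is bounded. -/

import Mathlib

universe u v

/-- Pomset automata over the alphabet `α` with state set `Q`, with a distinguished sink state.
`Sym2 Q` is the set of multisets of size two over `Q`. -/
structure PomsetAutomaton (α : Type u) (Q : Type v) where
  /-- the sequential transition function -/
  δ : Q → α → Q
  /-- the parallel transition function -/
  γ : Q → Sym2 Q → Q
  /-- the accepting states -/
  F : Set Q
  /-- the sink state -/
  bot : Q
  bot_not_mem : bot ∉ F
  δ_bot : ∀ a, δ bot a = bot
  γ_bot : ∀ φ, γ bot φ = bot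

namespace PomsetAutomaton

variable {α : Type u} {Q : Type v}

/-- The support of a state `q`: the two-element multisets `φ` such that `γ(q, φ)` and both elements
of `φ` differ from the sink state. -/
def support (A : PomsetAutomaton α Q) (q : Q) : Set (Sym2 Q) :=
  {φ | A.γ q φ ≠ A.bot ∧ ∀ r ∈ φ, r ≠ A.bot}

/-- `A.Reaches q q'` says that `q'` is in the reach of `q`. -/
inductive Reaches (A : PomsetAutomaton α Q) (q : Q) : Q → Prop
  | refl : Reaches A q q
  | seq {q' : Q} (a : α) : Reaches A q q' → Reaches A q (A.δ q' a)
  | par {q' : Q} (φ : Sym2 Q) : Reaches A q q' → φ ∈ A.support q' → Reaches A q (A.γ q' φ)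

/-- The reach of a state. -/
def reach (A : PomsetAutomaton α Q) (q : Q) : Set Q :=
  {q' | A.Reaches q q'}

/-- `lt` is a fork hierarchy of `A`. -/
structure IsForkHierarchy (A : PomsetAutomaton α Q) (lt : Q → Q → Prop) : Prop where
  irrefl : ∀ q, ¬ lt q q
  trans : ∀ q r s, lt q r → lt r s → lt q s
  fork : ∀ q r s, s(r, s) ∈ A.support q → lt r q ∧ lt s q
  seq : ∀ q r a, lt r (A.δ q a) → lt r q
  par : ∀ q r φ, φ ∈ A.support q → lt r (A.γ q φ) → lt r q

/-- `A` is fork-acyclic if it has a fork hierarchy. -/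
def IsForkAcyclic (A : PomsetAutomaton α Q) : Prop :=
  ∃ lt : Q → Q → Prop, A.IsForkHierarchy lt

/-- `A` is bounded if it has a well-founded fork hierarchy, and every state has finite support
and finite reach. -/
def IsBounded (A : PomsetAutomaton α Q) : Prop :=
  (∃ lt : Q → Q → Prop, A.IsForkHierarchy lt ∧ WellFounded lt) ∧
    ∀ q, (A.support q).Finite ∧ (A.reach q).Finite

end PomsetAutomaton

/-- Series-rational expressions over the alphabet `α`. -/
inductive SRExpr (α : Type u) : Type u
  | zero : SRExpr α
  | one : SRExpr α
  | sym (a : α) : SRExpr α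
  | add (e f : SRExpr α) : SRExpr α
  | seq (e f : SRExpr α) : SRExpr α
  | par (e f : SRExpr α) : SRExpr α
  | star (e : SRExpr α) : SRExpr α

namespace SRExpr

variable {α : Type u}

/-- The additive congruence: the smallest congruence containing the eight listed axioms. -/
inductive Cong : SRExpr α → SRExpr α → Prop
  | refl (e) : Cong e e
  | symm {e f} : Cong e f → Cong f e
  | trans {e f g} : Cong e f → Cong f g → Cong e g
  | add_congr {e e' f f'} : Cong e e' → Cong f f' → Cong (add e f) (add e' f')
  | seq_congr {e e' f f'} : Cong e e' → Cong f f' → Cong (seq e f) (seq e' f')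
  | par_congr {e e' f f'} : Cong e e' → Cong f f' → Cong (par e f) (par e' f')
  | star_congr {e e'} : Cong e e' → Cong (star e) (star e')
  | add_zero (e) : Cong (add e zero) e
  | add_idem (e) : Cong (add e e) e
  | add_comm (e f) : Cong (add e f) (add f e)
  | add_assoc (e f g) : Cong (add e (add f g)) (add (add e f) g)
  | zero_seq (e) : Cong (seq zero e) zero
  | seq_zero (e) : Cong (seq e zero) zero
  | zero_par (e) : Cong (par zero e) zero
  | par_zero (e) : Cong (par e zero) zero

/-- The additive congruence on multisets of size two. -/
def Cong₂ (φ ψ : Sym2 (SRExpr α)) : Prop :=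
  ∃ g h g' h', φ = s(g, h) ∧ ψ = s(g', h') ∧ Cong g g' ∧ Cong h h'

/-- The accepting expressions. -/
inductive Acc : SRExpr α → Prop
  | one : Acc one
  | add_left {e} (f) : Acc e → Acc (add e f)
  | add_right {e} (f) : Acc e → Acc (add f e)
  | seq {e f} : Acc e → Acc f → Acc (seq e f)
  | par {e f} : Acc e → Acc f → Acc (par e f)
  | star (e) : Acc (star e)

open Classical in
/-- `e ⋆ f`: this is `f` if `e` is accepting, and `0` otherwise. -/
noncomputable def guarded (e f : SRExpr α) : SRExpr α :=
  if Acc e then f else zero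

open Classical in
/-- The expression `[p]`: this is `1` if `p` holds, and `0` otherwise. -/
noncomputable def indicator (p : Prop) : SRExpr α :=
  if p then one else zero

/-- Sequential derivatives. -/
noncomputable def seqDeriv : SRExpr α → α → SRExpr α
  | zero, _ => zero
  | one, _ => zero
  | sym b, a => indicator (a = b)
  | add e f, a => add (seqDeriv e a) (seqDeriv f a)
  | seq e f, a => add (seq (seqDeriv e a) f) (guarded e (seqDeriv f a))
  | par e f, a => add (guarded e (seqDeriv f a)) (guarded f (seqDeriv e a))
  | star e, a => seq (seqDeriv e a) (star e)

/-- Parallel derivatives. -/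
noncomputable def parDeriv : SRExpr α → Sym2 (SRExpr α) → SRExpr α
  | zero, _ => zero
  | one, _ => zero
  | sym _, _ => zero
  | add e f, φ => add (parDeriv e φ) (parDeriv f φ)
  | seq e f, φ => add (seq (parDeriv e φ) f) (guarded e (parDeriv f φ))
  | par e f, φ =>
      add (add (indicator (Cong₂ φ s(e, f))) (guarded e (parDeriv f φ))) (guarded f (parDeriv e φ))
  | star e, φ => seq (parDeriv e φ) (star e)

open Classical in
/-- Parallel depth: it is `0` for `e ≃ 0`, and given by the recursive clauses otherwise. The
expressions `1`, `a` and `e*` are never congruent to `0`. -/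
noncomputable def depth : SRExpr α → ℕ
  | zero => 0
  | one => 0
  | sym _ => 1
  | add e f => if Cong (add e f) zero then 0 else max (depth e) (depth f)
  | seq e f => if Cong (seq e f) zero then 0 else max (depth e) (depth f)
  | par e f => if Cong (par e f) zero then 0 else max (depth e) (depth f) + 1
  | star e => depth e

/-! ### The quotient is well-defined -/

/-- Syntactic characterisation of the expressions congruent to `0`. -/
def IsNull : SRExpr α → Prop
  | zero => True
  | one => False
  | sym _ => False
  | add e f => IsNull e ∧ IsNull f
  | seq e f => IsNull e ∨ IsNull f
  | par e f => IsNull e ∨ IsNull f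
  | star _ => False

theorem Cong.isNull_iff {e f : SRExpr α} (h : Cong e f) : IsNull e ↔ IsNull f := by
  induction h <;> simp_all [IsNull, and_assoc, and_comm]

theorem IsNull.cong {e : SRExpr α} (h : IsNull e) : Cong e zero := by
  induction e with
  | zero => exact .refl _
  | one => exact h.elim
  | sym => exact h.elim
  | add e f he hf => exact .trans (.add_congr (he h.1) (hf h.2)) (.add_zero _)
  | seq e f he hf =>
    rcases h with h | h
    · exact .trans (.seq_congr (he h) (.refl _)) (.zero_seq _)
    · exact .trans (.seq_congr (.refl _) (hf h)) (.seq_zero _)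
  | par e f he hf =>
    rcases h with h | h
    · exact .trans (.par_congr (he h) (.refl _)) (.zero_par _)
    · exact .trans (.par_congr (.refl _) (hf h)) (.par_zero _)
  | star => exact h.elim

theorem cong_zero_iff {e : SRExpr α} : Cong e zero ↔ IsNull e :=
  ⟨fun h => h.isNull_iff.2 trivial, IsNull.cong⟩

theorem IsNull.depth_eq {e : SRExpr α} (h : IsNull e) : depth e = 0 := by
  cases e <;> simp_all [depth, cong_zero_iff, IsNull]

/-- Parallel depth does not depend on the representative of a congruence class. -/
theorem Cong.depth_eq {e f : SRExpr α} (h : Cong e f) : depth e = depth f := by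
  classical
  induction h with
  | refl => rfl
  | symm _ ih => exact ih.symm
  | trans _ _ ih₁ ih₂ => exact ih₁.trans ih₂
  | add_congr h₁ h₂ ih₁ ih₂ =>
    have h := Cong.add_congr h₁ h₂
    simp only [depth, ih₁, ih₂]
    exact if_congr ⟨h.symm.trans, h.trans⟩ rfl rfl
  | seq_congr h₁ h₂ ih₁ ih₂ =>
    have h := Cong.seq_congr h₁ h₂
    simp only [depth, ih₁, ih₂]
    exact if_congr ⟨h.symm.trans, h.trans⟩ rfl rfl
  | par_congr h₁ h₂ ih₁ ih₂ =>
    have h := Cong.par_congr h₁ h₂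
    simp only [depth, ih₁, ih₂]
    exact if_congr ⟨h.symm.trans, h.trans⟩ rfl rfl
  | star_congr _ ih => simpa only [depth] using ih
  | add_zero e =>
    by_cases he : IsNull e <;> simp [depth, cong_zero_iff, IsNull, he, IsNull.depth_eq]
  | add_idem e =>
    by_cases he : IsNull e <;> simp [depth, cong_zero_iff, IsNull, he, IsNull.depth_eq]
  | add_comm e f =>
    have h := Cong.add_comm e f
    simp only [depth]
    exact if_congr ⟨h.symm.trans, h.trans⟩ rfl (max_comm _ _)
  | add_assoc e f g =>
    by_cases he : IsNull e <;> by_cases hf : IsNull f <;> by_cases hg : IsNull g <;>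
      simp [depth, cong_zero_iff, IsNull, he, hf, hg, IsNull.depth_eq, max_assoc]
  | zero_seq e => simp [depth, cong_zero_iff, IsNull]
  | seq_zero e => simp [depth, cong_zero_iff, IsNull]
  | zero_par e => simp [depth, cong_zero_iff, IsNull]
  | par_zero e => simp [depth, cong_zero_iff, IsNull]

theorem not_acc_zero : ¬ Acc (zero : SRExpr α) := by
  intro h; cases h

theorem acc_add {e f : SRExpr α} : Acc (add e f) ↔ Acc e ∨ Acc f := by
  constructor
  · intro h
    cases h with
    | add_left _ h => exact .inl h
    | add_right _ h => exact .inr h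
  · rintro (h | h)
    · exact .add_left _ h
    · exact .add_right _ h

theorem acc_seq {e f : SRExpr α} : Acc (seq e f) ↔ Acc e ∧ Acc f := by
  constructor
  · intro h
    cases h with
    | seq h₁ h₂ => exact ⟨h₁, h₂⟩
  · exact fun h => .seq h.1 h.2

theorem acc_par {e f : SRExpr α} : Acc (par e f) ↔ Acc e ∧ Acc f := by
  constructor
  · intro h
    cases h with
    | par h₁ h₂ => exact ⟨h₁, h₂⟩
  · exact fun h => .par h.1 h.2

theorem Cong.acc_iff {e f : SRExpr α} (h : Cong e f) : Acc e ↔ Acc f := by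
  induction h with
  | refl => rfl
  | symm _ ih => exact ih.symm
  | trans _ _ ih₁ ih₂ => exact ih₁.trans ih₂
  | star_congr => exact ⟨fun _ => .star _, fun _ => .star _⟩
  | _ => simp_all [acc_add, acc_seq, acc_par, not_acc_zero, or_assoc, or_comm]

theorem guarded_congr {e e' f f' : SRExpr α} (h : Cong e e') (h' : Cong f f') :
    Cong (guarded e f) (guarded e' f') := by
  unfold guarded
  by_cases he : Acc e
  · rw [if_pos he, if_pos (h.acc_iff.1 he)]; exact h'
  · rw [if_neg he, if_neg (fun k => he (h.acc_iff.2 k))]; exact .refl _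

theorem guarded_zero (e : SRExpr α) : guarded e zero = zero := by
  simp [guarded]

theorem zero_guarded (e : SRExpr α) : guarded zero e = zero := by
  simp [guarded, not_acc_zero]

theorem Cong.seqDeriv {e f : SRExpr α} (h : Cong e f) (a : α) :
    Cong (e.seqDeriv a) (f.seqDeriv a) := by
  induction h with
  | refl => exact .refl _
  | symm _ ih => exact .symm ih
  | trans _ _ ih₁ ih₂ => exact .trans ih₁ ih₂
  | add_congr _ _ ih₁ ih₂ => exact .add_congr ih₁ ih₂
  | seq_congr h₁ h₂ ih₁ ih₂ => exact .add_congr (.seq_congr ih₁ h₂) (guarded_congr h₁ ih₂)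
  | par_congr h₁ h₂ ih₁ ih₂ => exact .add_congr (guarded_congr h₁ ih₂) (guarded_congr h₂ ih₁)
  | star_congr h ih => exact .seq_congr ih (.star_congr h)
  | add_zero => exact .add_zero _
  | add_idem => exact .add_idem _
  | add_comm => exact .add_comm _ _
  | add_assoc => exact .add_assoc _ _ _
  | zero_seq | seq_zero | zero_par | par_zero =>
    apply IsNull.cong
    simp [SRExpr.seqDeriv, IsNull, guarded_zero, zero_guarded]

theorem Cong₂.symm {φ ψ : Sym2 (SRExpr α)} (h : Cong₂ φ ψ) : Cong₂ ψ φ := by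
  obtain ⟨g, k, g', k', h₁, h₂, h₃, h₄⟩ := h
  exact ⟨g', k', g, k, h₂, h₁, .symm h₃, .symm h₄⟩

theorem cong₂_mk {g h e f : SRExpr α} :
    Cong₂ s(g, h) s(e, f) ↔ (Cong g e ∧ Cong h f) ∨ (Cong g f ∧ Cong h e) := by
  constructor
  · rintro ⟨a, b, c, d, h₁, h₂, h₃, h₄⟩
    rw [Sym2.eq_iff] at h₁ h₂
    rcases h₁ with ⟨rfl, rfl⟩ | ⟨rfl, rfl⟩ <;> rcases h₂ with ⟨rfl, rfl⟩ | ⟨rfl, rfl⟩ <;> simp [*]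
  · rintro (⟨h₁, h₂⟩ | ⟨h₁, h₂⟩)
    · exact ⟨g, h, e, f, rfl, rfl, h₁, h₂⟩
    · exact ⟨g, h, f, e, rfl, Sym2.eq_swap, h₁, h₂⟩

theorem Cong₂.trans {φ ψ χ : Sym2 (SRExpr α)} (h : Cong₂ φ ψ) (h' : Cong₂ ψ χ) : Cong₂ φ χ := by
  induction φ with | _ a b
  induction ψ with | _ c d
  induction χ with | _ e f
  rw [cong₂_mk] at *
  rcases h with ⟨h₁, h₂⟩ | ⟨h₁, h₂⟩ <;> rcases h' with ⟨h₃, h₄⟩ | ⟨h₃, h₄⟩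
  · exact .inl ⟨h₁.trans h₃, h₂.trans h₄⟩
  · exact .inr ⟨h₁.trans h₃, h₂.trans h₄⟩
  · exact .inr ⟨h₁.trans h₄, h₂.trans h₃⟩
  · exact .inl ⟨h₁.trans h₄, h₂.trans h₃⟩

theorem Cong.parDeriv {e f : SRExpr α} (h : Cong e f) {g k : SRExpr α}
    (hg : ¬ Cong g zero) (hk : ¬ Cong k zero) :
    Cong (e.parDeriv s(g, k)) (f.parDeriv s(g, k)) := by
  induction h with
  | refl => exact .refl _
  | symm _ ih => exact .symm ih
  | trans _ _ ih₁ ih₂ => exact .trans ih₁ ih₂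
  | add_congr _ _ ih₁ ih₂ => exact .add_congr ih₁ ih₂
  | seq_congr h₁ h₂ ih₁ ih₂ => exact .add_congr (.seq_congr ih₁ h₂) (guarded_congr h₁ ih₂)
  | @par_congr e e' f f' h₁ h₂ ih₁ ih₂ =>
    refine .add_congr (.add_congr ?_ (guarded_congr h₁ ih₂)) (guarded_congr h₂ ih₁)
    have h₃ : Cong₂ s(e, f) s(e', f') := cong₂_mk.2 (.inl ⟨h₁, h₂⟩)
    have h₄ : Cong₂ s(g, k) s(e, f) ↔ Cong₂ s(g, k) s(e', f') :=
      ⟨fun h => h.trans h₃, fun h => h.trans h₃.symm⟩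
    rw [h₄]
    exact .refl _
  | star_congr h ih => exact .seq_congr ih (.star_congr h)
  | add_zero => exact .add_zero _
  | add_idem => exact .add_idem _
  | add_comm => exact .add_comm _ _
  | add_assoc => exact .add_assoc _ _ _
  | zero_seq | seq_zero | zero_par | par_zero =>
    apply IsNull.cong
    simp [SRExpr.parDeriv, IsNull, guarded_zero, zero_guarded, cong₂_mk, hg, hk, indicator]

theorem parDeriv_eq_of_cong₂ (e : SRExpr α) {φ ψ : Sym2 (SRExpr α)} (h : Cong₂ φ ψ) :
    e.parDeriv φ = e.parDeriv ψ := by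
  induction e with
  | par e f he hf =>
    have h' : Cong₂ φ s(e, f) ↔ Cong₂ ψ s(e, f) := ⟨h.symm.trans, h.trans⟩
    simp only [parDeriv, he, hf, h']
  | _ => simp_all [parDeriv]

/-- The additive congruence as a setoid. -/
def congSetoid (α : Type u) : Setoid (SRExpr α) :=
  ⟨Cong, Cong.refl, Cong.symm, Cong.trans⟩

/-- The set of congruence classes of expressions. -/
def Classes (α : Type u) : Type u :=
  Quotient (congSetoid α)

/-- The congruence class `[e]`. -/
def cls (e : SRExpr α) : Classes α :=
  Quotient.mk (congSetoid α) e

theorem cls_eq_iff {e f : SRExpr α} : cls e = cls f ↔ Cong e f :=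
  ⟨fun h => Quotient.exact (s := congSetoid α) h, fun h => Quotient.sound (s := congSetoid α) h⟩

namespace Classes

/-- `δ([e], a) = [δ(e, a)]`. -/
noncomputable def seqDeriv (x : Classes α) (a : α) : Classes α :=
  Quotient.lift (s := congSetoid α) (fun e => cls (e.seqDeriv a))
    (fun _ _ h => cls_eq_iff.2 (Cong.seqDeriv h a)) x

open Classical in
/-- `γ([e], {[f], [g]})` on representatives: `[0]` if `f ≃ 0` or `g ≃ 0`, and `[γ(e, {f, g})]`
otherwise. -/
noncomputable def parDerivRep (e f g : SRExpr α) : Classes α :=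
  if Cong f zero ∨ Cong g zero then cls zero else cls (e.parDeriv s(f, g))

theorem parDerivRep_congr {e e' f f' g g' : SRExpr α} (he : Cong e e') (hf : Cong f f')
    (hg : Cong g g') : parDerivRep e f g = parDerivRep e' f' g' := by
  unfold parDerivRep
  have h₁ : Cong f zero ↔ Cong f' zero := ⟨hf.symm.trans, hf.trans⟩
  have h₂ : Cong g zero ↔ Cong g' zero := ⟨hg.symm.trans, hg.trans⟩
  by_cases h : Cong f zero ∨ Cong g zero
  · rw [if_pos h, if_pos (by rwa [← h₁, ← h₂])]
  · rw [if_neg h, if_neg (by rwa [← h₁, ← h₂])]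
    rw [not_or] at h
    rw [cls_eq_iff, ← parDeriv_eq_of_cong₂ e' (cong₂_mk.2 (.inl ⟨hf, hg⟩))]
    exact he.parDeriv h.1 h.2

theorem parDerivRep_comm (e f g : SRExpr α) : parDerivRep e f g = parDerivRep e g f := by
  classical
  unfold parDerivRep
  exact if_congr or_comm rfl (by rw [Sym2.eq_swap])

/-- `γ([e], {[f], [g]})` is `[0]` if `f ≃ 0` or `g ≃ 0`, and `[γ(e, {f, g})]` otherwise. -/
noncomputable def parDeriv (x : Classes α) (φ : Sym2 (Classes α)) : Classes α :=
  Sym2.lift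
    ⟨fun y z =>
      Quotient.lift (s := congSetoid α)
        (fun e => Quotient.lift₂ (s₁ := congSetoid α) (s₂ := congSetoid α) (parDerivRep e)
          (fun _ _ _ _ hf hg => parDerivRep_congr (.refl e) hf hg) y z)
        (fun e e' he => by
          induction y using Quotient.ind
          induction z using Quotient.ind
          exact parDerivRep_congr he (.refl _) (.refl _)) x,
      fun y z => by
        induction x using Quotient.ind
        induction y using Quotient.ind
        induction z using Quotient.ind
        exact parDerivRep_comm _ _ _⟩ φ

/-- Parallel depth of a congruence class. -/
noncomputable def depth (x : Classes α) : ℕ :=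
  Quotient.lift (s := congSetoid α) SRExpr.depth (fun _ _ h => Cong.depth_eq h) x

/-- `[e] ≺ [f]` if and only if the parallel depth of `e` is less than that of `f`. -/
def DepthLt (x y : Classes α) : Prop :=
  depth x < depth y

end Classes

/-- The quotiented syntactic PA, with sink state `[0]`. -/
noncomputable def quotientPA (α : Type u) : PomsetAutomaton α (Classes α) where
  δ := Classes.seqDeriv
  γ := Classes.parDeriv
  F := {x | ∃ e, Acc e ∧ x = cls e}
  bot := cls zero
  bot_not_mem := by
    rintro ⟨e, he, h⟩
    exact not_acc_zero ((cls_eq_iff.1 h).acc_iff.2 he)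
  δ_bot := fun _ => rfl
  γ_bot := by
    intro φ
    induction φ with | _ y z
    induction y using Quotient.ind
    induction z using Quotient.ind
    exact ite_self _

end SRExpr

/-! Letters and forks can be treated alike. Restricted to pairs whose components are not congruent
to 0, parallel derivatives respect `Cong` and obey nearly the same recursion as sequential ones, and
every move along the support is of this kind. The restriction is essential: `0 ∥ f` is congruent to
0, yet its derivative by `{0, f}` contains the summand 1.

Fork hierarchy: no derivative raises the depth (`depth_deriv_le`). A fork with nonzero result must
match, up to congruence, the operands of some subexpression `e ∥ f`, and the extra 1 in the depth of
`e ∥ f` puts both strictly below (`depth_lt_of_not_isNull_parDeriv`). Well-foundedness is inherited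
from the natural numbers. The same matching bounds the support by the finitely many parallel
subexpressions (`mem_parPairs_of_not_isNull_parDeriv`).

Finite reach is an Antimirov-style argument. Under `+` the classes form a semilattice and derivation
preserves joins. Finitely generated semilattices are finite, so it suffices to find finitely many
generators whose derivatives are sums of generators (`isRegular_of_mem`); these are built by
recursion on the expression (`Classes.isRegular`). -/

namespace SRExpr

variable {α : Type u}

/-! ### Both kinds of derivatives at once -/

/-- The labels of transitions: letters, and multisets of two expressions not congruent to `0`. -/
abbrev Label (α : Type u) : Type u :=
  α ⊕ {φ : Sym2 (SRExpr α) // ∀ r ∈ φ, ¬ Cong r zero}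

/-- The derivative with respect to a label. -/
noncomputable def deriv (e : SRExpr α) : Label α → SRExpr α
  | .inl a => e.seqDeriv a
  | .inr φ => e.parDeriv φ.1

theorem Cong.deriv {e f : SRExpr α} (h : Cong e f) (l : Label α) :
    Cong (e.deriv l) (f.deriv l) := by
  rcases l with a | ⟨φ, hφ⟩
  · exact h.seqDeriv a
  · induction φ with | _ g k
    exact h.parDeriv (hφ g (Sym2.mem_mk_left g k)) (hφ k (Sym2.mem_mk_right g k))

theorem deriv_zero (l : Label α) : deriv zero l = zero := by
  rcases l with a | φ <;> rfl

theorem deriv_one (l : Label α) : deriv one l = zero := by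
  rcases l with a | φ <;> rfl

theorem indicator_eq (p : Prop) :
    (indicator p : SRExpr α) = zero ∨ (indicator p : SRExpr α) = one := by
  unfold indicator
  split_ifs <;> simp

theorem guarded_eq (e f : SRExpr α) : guarded e f = zero ∨ guarded e f = f := by
  unfold guarded
  split_ifs <;> simp

theorem deriv_sym (b : α) (l : Label α) : deriv (sym b) l = zero ∨ deriv (sym b) l = one := by
  rcases l with a | φ
  · exact indicator_eq _
  · exact .inl rfl

theorem deriv_add (e f : SRExpr α) (l : Label α) :
    deriv (add e f) l = add (deriv e l) (deriv f l) := by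
  rcases l with a | φ <;> rfl

theorem deriv_seq (e f : SRExpr α) (l : Label α) :
    deriv (seq e f) l = add (seq (deriv e l) f) (guarded e (deriv f l)) := by
  rcases l with a | φ <;> rfl

theorem deriv_star (e : SRExpr α) (l : Label α) :
    deriv (star e) l = seq (deriv e l) (star e) := by
  rcases l with a | φ <;> rfl

/-- Up to congruence, the derivative of `e ∥ f` is a sum of an indicator and guarded derivatives. -/
theorem deriv_par (e f : SRExpr α) (l : Label α) :
    ∃ p, Cong (deriv (par e f) l)
      (add (add (indicator p) (guarded e (deriv f l))) (guarded f (deriv e l))) := by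
  rcases l with a | φ
  -- Letter derivatives have no indicator summand; `False` pads with a 0, giving both kinds of label
  -- the same shape.
  · refine ⟨False, .add_congr ?_ (.refl _)⟩
    simp only [indicator, if_false]
    exact (Cong.trans (.add_comm _ _) (.add_zero _)).symm
  · exact ⟨_, .refl _⟩

/-- Needed because `depth` is reset to 0 on null expressions: wherever the recursive clause for
`depth` is unavailable, the derivative is null too. -/
theorem IsNull.deriv {e : SRExpr α} (h : IsNull e) (l : Label α) : IsNull (e.deriv l) :=
  cong_zero_iff.1 (deriv_zero l ▸ h.cong.deriv l)

/-! ### Parallel depth of derivatives -/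

theorem depth_add_le (e f : SRExpr α) : depth (add e f) ≤ max (depth e) (depth f) := by
  simp only [depth]; split_ifs <;> simp

theorem depth_seq_le (e f : SRExpr α) : depth (seq e f) ≤ max (depth e) (depth f) := by
  simp only [depth]; split_ifs <;> simp

theorem depth_guarded_le (e f : SRExpr α) : depth (guarded e f) ≤ depth f := by
  rcases guarded_eq e f with h | h <;> simp [h, depth]

theorem depth_indicator (p : Prop) : depth (indicator p : SRExpr α) = 0 := by
  rcases indicator_eq (α := α) p with h | h <;> simp [h, depth]

theorem depth_add {e f : SRExpr α} (h : ¬ IsNull (add e f)) :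
    depth (add e f) = max (depth e) (depth f) := by
  simp [depth, cong_zero_iff, h]

theorem depth_seq {e f : SRExpr α} (h : ¬ IsNull (seq e f)) :
    depth (seq e f) = max (depth e) (depth f) := by
  simp [depth, cong_zero_iff, h]

theorem depth_par {e f : SRExpr α} (h : ¬ IsNull (par e f)) :
    depth (par e f) = max (depth e) (depth f) + 1 := by
  simp [depth, cong_zero_iff, h]

/-- Each summand of a derivative is built from derivatives of subexpressions and unchanged
subexpressions, with no new `∥`. Null expressions are split off because their depth is 0 whatever
their parts are. -/
theorem depth_deriv_le (e : SRExpr α) (l : Label α) : depth (e.deriv l) ≤ depth e := by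
  induction e with
  | zero => simp [deriv_zero]
  | one => simp [deriv_one, depth]
  | sym b => rcases deriv_sym b l with h | h <;> simp [h, depth]
  | add e f he hf =>
    by_cases h : IsNull (add e f)
    · simp [(h.deriv l).depth_eq]
    · rw [deriv_add, depth_add h]
      exact (depth_add_le _ _).trans (max_le_max he hf)
  | seq e f he hf =>
    by_cases h : IsNull (seq e f)
    · simp [(h.deriv l).depth_eq]
    · rw [deriv_seq, depth_seq h]
      have h₁ := depth_add_le (seq (e.deriv l) f) (guarded e (f.deriv l))
      have h₂ := depth_seq_le (e.deriv l) f
      have h₃ := depth_guarded_le e (f.deriv l)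
      omega
  | par e f he hf =>
    by_cases h : IsNull (par e f)
    · simp [(h.deriv l).depth_eq]
    · obtain ⟨p, hp⟩ := deriv_par e f l
      rw [hp.depth_eq, depth_par h]
      have h₁ := depth_add_le (add (indicator p) (guarded e (f.deriv l))) (guarded f (e.deriv l))
      have h₂ := depth_add_le (indicator p) (guarded e (f.deriv l))
      have h₃ := depth_guarded_le e (f.deriv l)
      have h₄ := depth_guarded_le f (e.deriv l)
      have h₅ := depth_indicator (α := α) p
      omega
  | star e he =>
    rw [deriv_star]
    have h₁ := depth_seq_le (e.deriv l) (star e)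
    have h₂ : depth (star e) = depth e := rfl
    omega

theorem isNull_guarded {e f : SRExpr α} (h : IsNull f) : IsNull (guarded e f) := by
  rcases guarded_eq e f with h' | h' <;> rw [h']
  exacts [trivial, h]

theorem of_not_isNull_indicator {p : Prop} (h : ¬ IsNull (indicator p : SRExpr α)) : p := by
  by_contra hp
  exact h (by simp [indicator, hp, IsNull])

/-- Forking strictly decreases the parallel depth. -/
theorem depth_lt_of_not_isNull_parDeriv (e : SRExpr α) {g k : SRExpr α} (hg : ¬ Cong g zero)
    (hk : ¬ Cong k zero) (h : ¬ IsNull (e.parDeriv s(g, k))) :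
    depth g < depth e ∧ depth k < depth e := by
  have hφ : ∀ r ∈ s(g, k), ¬ Cong r zero := by simp [hg, hk]
  -- Non-nullity makes the depth of `e` equal to its recursive formula. The pair is a label by `hφ`,
  -- so the same argument applies to the subexpressions.
  have hnull : ¬ IsNull e := fun he => h (he.deriv (.inr ⟨_, hφ⟩))
  induction e with
  | zero | one | sym => exact (h trivial).elim
  | add e f he hf =>
    rw [depth_add hnull]
    by_cases h' : IsNull (e.parDeriv s(g, k))
    · have h'' : ¬ IsNull (f.parDeriv s(g, k)) := fun h'' => h ⟨h', h''⟩
      have := hf h'' fun hn => h'' (hn.deriv (.inr ⟨_, hφ⟩))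
      omega
    · have := he h' fun hn => h' (hn.deriv (.inr ⟨_, hφ⟩))
      omega
  | seq e f he hf =>
    rw [depth_seq hnull]
    by_cases h' : IsNull (e.parDeriv s(g, k))
    · have h'' : ¬ IsNull (f.parDeriv s(g, k)) := fun h'' => h ⟨.inl h', isNull_guarded h''⟩
      have := hf h'' fun hn => h'' (hn.deriv (.inr ⟨_, hφ⟩))
      omega
    · have := he h' fun hn => h' (hn.deriv (.inr ⟨_, hφ⟩))
      omega
  | par e f he hf =>
    rw [depth_par hnull]
    by_cases h' : IsNull (e.parDeriv s(g, k))
    · by_cases h'' : IsNull (f.parDeriv s(g, k))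
      -- Both derivative summands vanish, so the indicator is nonzero. The `+ 1` in the depth of `e
      -- ∥ f` makes the inequalities strict.
      · have hc : Cong₂ s(g, k) s(e, f) := of_not_isNull_indicator fun hi =>
          h ⟨⟨hi, isNull_guarded h''⟩, isNull_guarded h'⟩
        rcases cong₂_mk.1 hc with ⟨h₁, h₂⟩ | ⟨h₁, h₂⟩ <;>
          rw [h₁.depth_eq, h₂.depth_eq] <;> omega
      · have := hf h'' fun hn => h'' (hn.deriv (.inr ⟨_, hφ⟩))
        omega
    · have := he h' fun hn => h' (hn.deriv (.inr ⟨_, hφ⟩))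
      omega
  | star e he =>
    have h' : ¬ IsNull (e.parDeriv s(g, k)) := fun h' => h (.inl h')
    exact he h' fun hn => h' (hn.deriv (.inr ⟨_, hφ⟩))

/-! ### Finiteness of the support -/

/-- The pairs `{[e], [f]}` for the subexpressions `e ∥ f` of an expression. -/
def parPairs : SRExpr α → Set (Sym2 (Classes α))
  | zero => ∅
  | one => ∅
  | sym _ => ∅
  | add e f => parPairs e ∪ parPairs f
  | seq e f => parPairs e ∪ parPairs f
  | par e f => insert s(cls e, cls f) (parPairs e ∪ parPairs f)
  | star e => parPairs e

theorem finite_parPairs (e : SRExpr α) : (parPairs e).Finite := by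
  induction e <;> simp_all [parPairs]

/-- Every nonzero parallel derivative originates in an indicator at some `∥`. The indicator tests
only up to congruence, hence pairs of classes. -/
theorem mem_parPairs_of_not_isNull_parDeriv (e : SRExpr α) {g k : SRExpr α}
    (h : ¬ IsNull (e.parDeriv s(g, k))) : s(cls g, cls k) ∈ parPairs e := by
  induction e with
  | zero | one | sym => exact (h trivial).elim
  | add e f he hf =>
    by_cases h' : IsNull (e.parDeriv s(g, k))
    · exact .inr (hf fun h'' => h ⟨h', h''⟩)
    · exact .inl (he h')
  | seq e f he hf =>
    by_cases h' : IsNull (e.parDeriv s(g, k))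
    · exact .inr (hf fun h'' => h ⟨.inl h', isNull_guarded h''⟩)
    · exact .inl (he h')
  | par e f he hf =>
    by_cases h' : IsNull (e.parDeriv s(g, k))
    · by_cases h'' : IsNull (f.parDeriv s(g, k))
      · have hc : Cong₂ s(g, k) s(e, f) := of_not_isNull_indicator fun hi =>
          h ⟨⟨hi, isNull_guarded h''⟩, isNull_guarded h'⟩
        refine .inl (Sym2.eq_iff.2 ?_)
        simpa only [cls_eq_iff] using cong₂_mk.1 hc
      · exact .inr (.inr (hf h''))
    · exact .inr (.inl (he h'))
  | star e he => exact he fun h' => h (.inl h')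

/-! ### Finiteness of the reach -/

namespace Classes

/-- Addition of expressions makes the congruence classes a semilattice. -/
instance : SemilatticeSup (Classes α) :=
  letI : Max (Classes α) :=
    ⟨Quotient.map₂ (sa := congSetoid α) (sb := congSetoid α) (sc := congSetoid α) add
      fun _ _ h _ _ h' => .add_congr h h'⟩
  SemilatticeSup.mk'
    (by
      rintro ⟨e⟩ ⟨f⟩
      exact cls_eq_iff.2 (.add_comm e f))
    (by
      rintro ⟨e⟩ ⟨f⟩ ⟨g⟩
      exact cls_eq_iff.2 (Cong.add_assoc e f g).symm)
    (by
      rintro ⟨e⟩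
      exact cls_eq_iff.2 (.add_idem e))

theorem cls_add (e f : SRExpr α) : cls (add e f) = cls e ⊔ cls f := rfl

/-- The derivative of a class with respect to a label. -/
noncomputable def deriv (x : Classes α) (l : Label α) : Classes α :=
  Quotient.lift (s := congSetoid α) (fun e => cls (e.deriv l))
    (fun _ _ h => cls_eq_iff.2 (h.deriv l)) x

theorem deriv_cls (e : SRExpr α) (l : Label α) : (cls e).deriv l = cls (e.deriv l) := rfl

theorem deriv_sup (x y : Classes α) (l : Label α) :
    (x ⊔ y).deriv l = x.deriv l ⊔ y.deriv l := by
  rcases x with ⟨e⟩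
  rcases y with ⟨f⟩
  exact congrArg cls (deriv_add e f l)

/-- Right multiplication of a class by an expression. -/
def mulRight (f : SRExpr α) (x : Classes α) : Classes α :=
  Quotient.lift (s := congSetoid α) (fun e => cls (seq e f))
    (fun _ _ h => cls_eq_iff.2 (.seq_congr h (.refl f))) x

/-- Which case holds depends on whether `x` accepts, but closure arguments need only the two
possible shapes. The summand 0 stands for a failed guard. -/
theorem deriv_mulRight (x : Classes α) (f : SRExpr α) (l : Label α) :
    (mulRight f x).deriv l = mulRight f (x.deriv l) ⊔ cls zero ∨
      (mulRight f x).deriv l = mulRight f (x.deriv l) ⊔ cls (f.deriv l) := by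
  rcases x with ⟨e⟩
  refine (guarded_eq e (f.deriv l)).imp (fun h => ?_) fun h => ?_
  all_goals exact congrArg cls ((deriv_seq e f l).trans (by rw [h]))

/-- A set of classes closed under derivatives. -/
def IsStable (S : Set (Classes α)) : Prop :=
  ∀ x ∈ S, ∀ l, x.deriv l ∈ S

/-- Since derivation preserves joins, the classes all of whose derivatives lie in the closure are
closed under joins, so checking generators suffices. -/
theorem isStable_supClosure {T : Set (Classes α)} (h : ∀ x ∈ T, ∀ l, x.deriv l ∈ supClosure T) :
    IsStable (supClosure T) :=
  supClosure_min (t := {x : Classes α | ∀ l, x.deriv l ∈ supClosure T}) h fun x hx y hy l => by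
    rw [deriv_sup]
    exact supClosed_supClosure (hx l) (hy l)

/-- A class is regular if it lies in a finite set of classes that contains `0` and is closed under
derivatives. -/
def IsRegular (x : Classes α) : Prop :=
  ∃ S : Set (Classes α), S.Finite ∧ IsStable S ∧ cls zero ∈ S ∧ x ∈ S

/-- The join closure of a finite set is finite. Keeping 0 among the generators accounts for summands
killed by a guard or an indicator. -/
theorem isRegular_of_mem {T : Set (Classes α)} (hT : T.Finite) (h₀ : cls zero ∈ T)
    (h : ∀ x ∈ T, ∀ l, x.deriv l ∈ supClosure T) {x : Classes α} (hx : x ∈ T) : IsRegular x :=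
  ⟨supClosure T, hT.supClosure, isStable_supClosure h, subset_supClosure h₀, subset_supClosure hx⟩

theorem isRegular_cls_add {e f : SRExpr α} (he : IsRegular (cls e)) (hf : IsRegular (cls f)) :
    IsRegular (cls (add e f)) := by
  obtain ⟨S, hS, hS', hS₀, heS⟩ := he
  obtain ⟨R, hR, hR', hR₀, hfR⟩ := hf
  refine ⟨supClosure (S ∪ R), (hS.union hR).supClosure, isStable_supClosure ?_,
    subset_supClosure (.inl hS₀),
    supClosed_supClosure (subset_supClosure (Set.mem_union_left R heS))
      (subset_supClosure (Set.mem_union_right S hfR))⟩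
  rintro x (hx | hx) l
  · exact subset_supClosure (.inl (hS' x hx l))
  · exact subset_supClosure (.inr (hR' x hx l))

theorem isRegular_cls_seq {e f : SRExpr α} (he : IsRegular (cls e)) (hf : IsRegular (cls f)) :
    IsRegular (cls (seq e f)) := by
  obtain ⟨S, hS, hS', hS₀, heS⟩ := he
  obtain ⟨R, hR, hR', hR₀, hfR⟩ := hf
  -- A derivative of `x · f` is `x' · f`, possibly plus a derivative of `f`: the first stays in `S ·
  -- f`, the second in `R`.
  refine isRegular_of_mem (T := mulRight f '' S ∪ R) ((hS.image _).union hR) (.inr hR₀) ?_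
    (.inl ⟨_, heS, rfl⟩)
  rintro _ (⟨x, hx, rfl⟩ | hx) l
  · have h := subset_supClosure (s := mulRight f '' S ∪ R) (.inl ⟨_, hS' x hx l, rfl⟩)
    rcases deriv_mulRight x f l with h' | h' <;> rw [h']
    · exact supClosed_supClosure h (subset_supClosure (.inr hR₀))
    · exact supClosed_supClosure h (subset_supClosure (.inr (hR' _ hfR l)))
  · exact subset_supClosure (.inr (hR' _ hx l))

theorem isRegular_cls_par {e f : SRExpr α} (he : IsRegular (cls e)) (hf : IsRegular (cls f)) :
    IsRegular (cls (par e f)) := by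
  obtain ⟨S, hS, hS', hS₀, heS⟩ := he
  obtain ⟨R, hR, hR', hR₀, hfR⟩ := hf
  -- One step from `e ∥ f` already removes the `∥`: what remains is a sum of an indicator (hence the
  -- generator 1) and derivatives of `e` and `f` alone.
  refine isRegular_of_mem (T := {cls (par e f), cls one} ∪ (S ∪ R))
    ((Set.toFinite _).union (hS.union hR)) (.inr (.inl hS₀)) ?_ (.inl (.inl rfl))
  rintro _ ((rfl | rfl) | (hx | hx)) l
  · obtain ⟨p, hp⟩ := deriv_par e f l
    rw [deriv_cls, cls_eq_iff.2 hp, cls_add, cls_add]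
    refine supClosed_supClosure (supClosed_supClosure ?_ ?_) ?_ <;> apply subset_supClosure
    · rcases indicator_eq (α := α) p with h | h <;> rw [h]
      exacts [.inr (.inl hS₀), .inl (.inr rfl)]
    · rcases guarded_eq e (f.deriv l) with h | h <;> rw [h]
      exacts [.inr (.inl hS₀), .inr (.inr (hR' _ hfR l))]
    · rcases guarded_eq f (e.deriv l) with h | h <;> rw [h]
      exacts [.inr (.inl hS₀), .inr (.inl (hS' _ heS l))]
  · rw [deriv_cls, deriv_one]
    exact subset_supClosure (.inr (.inl hS₀))
  · exact subset_supClosure (.inr (.inl (hS' _ hx l)))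
  · exact subset_supClosure (.inr (.inr (hR' _ hx l)))

theorem isRegular_cls_star {e : SRExpr α} (he : IsRegular (cls e)) :
    IsRegular (cls (star e)) := by
  obtain ⟨S, hS, hS', hS₀, heS⟩ := he
  -- The generators are `e*` and `S · e*`; 0 is among them as `0 · e*`.
  have h₀ : cls zero = mulRight (star e) (cls zero) := cls_eq_iff.2 (Cong.zero_seq _).symm
  refine isRegular_of_mem (T := insert (cls (star e)) (mulRight (star e) '' S))
    ((hS.image _).insert _) (.inr ⟨_, hS₀, h₀.symm⟩) ?_ (.inl rfl)
  have hd : ∀ x ∈ S, ∀ l, mulRight (star e) (x.deriv l) ∈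
      supClosure (insert (cls (star e)) (mulRight (star e) '' S)) := fun x hx l =>
    subset_supClosure (.inr ⟨_, hS' x hx l, rfl⟩)
  rintro _ (rfl | ⟨x, hx, rfl⟩) l
  · rw [deriv_cls, deriv_star]
    exact hd _ heS l
  · rcases deriv_mulRight x (star e) l with h' | h' <;> rw [h']
    · exact supClosed_supClosure (hd x hx l) (subset_supClosure (.inr ⟨_, hS₀, h₀.symm⟩))
    -- The extra summand is a derivative of `e*`, which is `e' · e*` and so again in `S · e*`.
    · rw [deriv_star]
      exact supClosed_supClosure (hd x hx l) (hd _ heS l)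

theorem isRegular (x : Classes α) : IsRegular x := by
  rcases x with ⟨e⟩
  change IsRegular (cls e)
  induction e with
  | zero => exact ⟨{cls zero}, Set.finite_singleton _, by simp [IsStable, deriv_cls, deriv_zero],
      rfl, rfl⟩
  | one => exact ⟨{cls zero, cls one}, Set.toFinite _,
      by simp [IsStable, deriv_cls, deriv_zero, deriv_one], .inl rfl, .inr rfl⟩
  | sym b =>
    refine ⟨{cls zero, cls one, cls (sym b)}, Set.toFinite _, ?_, .inl rfl, .inr (.inr rfl)⟩
    rintro _ (rfl | rfl | rfl) l
    · exact .inl (congrArg cls (deriv_zero l))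
    · exact .inl (congrArg cls (deriv_one l))
    · rcases deriv_sym b l with h | h
      exacts [.inl (congrArg cls h), .inr (.inl (congrArg cls h))]
  | add e f he hf => exact isRegular_cls_add he hf
  | seq e f he hf => exact isRegular_cls_seq he hf
  | par e f he hf => exact isRegular_cls_par he hf
  | star e he => exact isRegular_cls_star he

end Classes

/-! ### The quotiented syntactic pomset automaton -/

theorem mem_support_quotientPA {e g k : SRExpr α} :
    s(cls g, cls k) ∈ (quotientPA α).support (cls e) ↔
      ¬ IsNull (e.parDeriv s(g, k)) ∧ ¬ Cong g zero ∧ ¬ Cong k zero := by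
  have hγ : (quotientPA α).γ (cls e) s(cls g, cls k) = Classes.parDerivRep e g k := rfl
  have hbot : (quotientPA α).bot = cls zero := rfl
  simp only [PomsetAutomaton.support, Set.mem_ofPred_eq, hγ, hbot, Sym2.mem_iff,
    forall_eq_or_imp, forall_eq, ne_eq, cls_eq_iff]
  refine and_congr_left fun h => ?_
  rw [Classes.parDerivRep, if_neg (not_or.2 h), cls_eq_iff, cong_zero_iff]

/-- On its support, `γ` is a derivative. -/
theorem exists_γ_eq_deriv {x : Classes α} {φ : Sym2 (Classes α)}
    (h : φ ∈ (quotientPA α).support x) : ∃ l, (quotientPA α).γ x φ = x.deriv l := by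
  rcases x with ⟨e⟩
  induction φ with | _ y z
  rcases y with ⟨g⟩
  rcases z with ⟨k⟩
  obtain ⟨-, hg, hk⟩ := mem_support_quotientPA.1 h
  refine ⟨.inr ⟨s(g, k), by simp [hg, hk]⟩, ?_⟩
  exact if_neg (not_or.2 ⟨hg, hk⟩)

theorem Classes.depth_deriv_le (x : Classes α) (l : Label α) : (x.deriv l).depth ≤ x.depth := by
  rcases x with ⟨e⟩
  exact SRExpr.depth_deriv_le e l

theorem isForkHierarchy_depthLt : (quotientPA α).IsForkHierarchy Classes.DepthLt where
  irrefl _ := lt_irrefl _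
  trans _ _ _ := lt_trans
  fork := by
    rintro ⟨e⟩ ⟨g⟩ ⟨k⟩ h
    obtain ⟨h, hg, hk⟩ := mem_support_quotientPA.1 h
    exact depth_lt_of_not_isNull_parDeriv e hg hk h
  seq q _ a h := h.trans_le (q.depth_deriv_le (.inl a))
  par q r φ hφ h := by
    obtain ⟨l, hl⟩ := exists_γ_eq_deriv hφ
    rw [hl] at h
    exact h.trans_le (q.depth_deriv_le l)

theorem wellFounded_depthLt : WellFounded (Classes.DepthLt (α := α)) :=
  InvImage.wf Classes.depth Nat.lt_wfRel.wf

theorem finite_support_quotientPA (q : Classes α) : ((quotientPA α).support q).Finite := by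
  rcases q with ⟨e⟩
  refine (finite_parPairs e).subset fun φ h => ?_
  induction φ with | _ y z
  rcases y with ⟨g⟩
  rcases z with ⟨k⟩
  exact mem_parPairs_of_not_isNull_parDeriv e (mem_support_quotientPA.1 h).1

/-- Every step of the reach is a derivative by some label, so a stable finite set containing `q`
traps the whole reach. -/
theorem finite_reach_quotientPA (q : Classes α) : ((quotientPA α).reach q).Finite := by
  obtain ⟨S, hS, hS', -, hq⟩ := q.isRegular
  refine hS.subset fun x (hx : (quotientPA α).Reaches q x) => ?_
  induction hx with
  | refl => exact hq
  | seq a _ ih => exact hS' _ ih (.inl a)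
  | par φ _ hφ ih =>
    obtain ⟨l, hl⟩ := exists_γ_eq_deriv hφ
    exact hl ▸ hS' _ ih l

end SRExpr

theorem mainTheorem3 (α : Type*) [Finite α] :
    (SRExpr.quotientPA α).IsForkHierarchy SRExpr.Classes.DepthLt ∧
    WellFounded (SRExpr.Classes.DepthLt (α := α)) ∧
    (SRExpr.quotientPA α).IsForkAcyclic ∧
    (∀ q, ((SRExpr.quotientPA α).reach q).Finite) ∧
    (∀ q, ((SRExpr.quotientPA α).support q).Finite) ∧
    (SRExpr.quotientPA α).IsBounded :=
  ⟨SRExpr.isForkHierarchy_depthLt, SRExpr.wellFounded_depthLt,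
    ⟨_, SRExpr.isForkHierarchy_depthLt⟩, SRExpr.finite_reach_quotientPA,
    SRExpr.finite_support_quotientPA,
    ⟨_, SRExpr.isForkHierarchy_depthLt, SRExpr.wellFounded_depthLt⟩,
    fun q => ⟨SRExpr.finite_support_quotientPA q, SRExpr.finite_reach_quotientPA q⟩⟩
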